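/- **Setting.** Fix $n\ge 1$ documents $d_1,\dots,d_n$ and a document index $k$ (the ground truth). Let $m=n-1$, and index the coordinates of $\mathbb R^m$ by the competitors $j\neq k$. A problem instance, conditioned on the realized query, consists of a vocabulary $\{1,\dots,N\}$, query term counts $c_{q}\in\mathbb N^N$ with $L_q=\sum_i c_{q,i}$, a set $\mathcal L_s$ of stop words, document term counts, an erasure probability $\epsilon\in[0,1]$ and a rate $R>0$. From these put - $v_{q,i}=c_{q,i}/L_q$ for $i\notin\mathcal L_s$ and $v_{q,i}=0$ for $i\in\mathcal L_s$; $\mathcal S_q=\{i: v_{q,i}\ne0\}$, $K_q=|\mathcal S_q|$; $M=\sum_{i\notin\mathcal L_s}c_{q,i}$; - $r_i=\bigl\lceil \frac{M}{R\sum_l v_{q,l}}\,v_{q,i}\bigr\rceil$ and $p_i=1-\epsilon^{r_i}$; - $v_{d_j}$, the term-frequency vector of $d_j$ (counts divided by document length; the zero vector for an empty document), and $\zeta_i=\log\frac{n+1}{n_i+1}$, where $n_i$ is the number of documents containing term $i$; - independent indicators $e_i$ with $\Pr(e_i=1)=1-\epsilon^{r_i}$ and $\Pr(e_i=0)=\epsilon^{r_i}$;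 - the scores $\hat s_j=\sum_{i\in\mathcal S_q}\zeta_i^2(e_iv_{q,i}-v_{d_j,i})^2$ and the margin vector $\widehat{\boldsymbol\Delta}=(\hat s_j-\hat s_k)_{j\ne k}\in\mathbb R^m$; - $\mathbf C_i=\bigl(\zeta_i^2(v_{d_j,i}^2-v_{d_k,i}^2)\bigr)_{j\neq k}$, $\boldsymbol\delta_i=\bigl(2\zeta_i^2v_{q,i}(v_{d_k,i}-v_{d_j,i})\bigr)_{j\ne k}$, $\mathbf Y_i=(e_i-p_i)\boldsymbol\delta_i$, $$\boldsymbol\mu(\mathbf v_q)=\sum_{i\in\mathcal S_q}(\mathbf C_i+p_i\boldsymbol\delta_i),\qquad \boldsymbol\Sigma(\mathbf v_q)=\sum_{i\in\mathcal S_q}p_i(1-p_i)\boldsymbol\delta_i\boldsymbol\delta_i^\top .$$ **Statement.** Consider a sequence of such instances, indexed by $t$ (all quantities but $n$ and $k$ may depend on $t$), with $N\to\infty$ and $K_q\to\infty$. Assume the directional Lindeberg condition: for every fixed unit vector $\mathbf u\in\mathbb R^m$ and every $\eta>0$, $$\frac1{\mathbf u^\top\boldsymbol\Sigma(\mathbf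 v_q)\mathbf u}\sum_{i\in\mathcal S_q}\mathbb E\Bigl[(\mathbf u^\top\mathbf Y_i)^2\,\mathbf 1\bigl\{|\mathbf u^\top\mathbf Y_i|>\eta\sqrt{\mathbf u^\top\boldsymbol\Sigma(\mathbf v_q)\mathbf u}\bigr\}\Bigr]\longrightarrow0,$$ where the left side is read as $0$ when $\mathbf u^\top\boldsymbol\Sigma(\mathbf v_q)\mathbf u=0$. Then $\widehat{\boldsymbol\Delta}=\sum_{i\in\mathcal S_q}(\mathbf C_i+e_i\boldsymbol\delta_i)$, the vectors $\mathbf C_i+e_i\boldsymbol\delta_i$ are independent, and $\widehat{\boldsymbol\Delta}\xrightarrow{d}\mathcal N(\boldsymbol\mu(\mathbf v_q),\boldsymbol\Sigma(\mathbf v_q))$ along the sequence. As the Gaussian law moves with $t$, this convergence means all of the following, where $\mathbf G\sim\mathcal N(\boldsymbol\mu(\mathbf v_q),\boldsymbol\Sigma(\mathbf v_q))$: 1. $\mathbb E f(\widehat{\boldsymbol\Delta})-\mathbb E f(\mathbf G)\to0$ for every bounded continuous $f:\mathbb R^m\to\mathbb R$. 2. For all fixed $\mathbf u_1,\dots,\mathbf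 u_d\in\mathbb R^m$ let $T(\mathbf x)=\bigl(\mathbf u_l^\top(\mathbf x-\boldsymbol\mu(\mathbf v_q))/\sqrt{\mathbf u_l^\top\boldsymbol\Sigma(\mathbf v_q)\mathbf u_l}\bigr)_{l\le d}$, a coordinate with zero denominator being read as $0$. Then $\mathbb E f(T(\widehat{\boldsymbol\Delta}))-\mathbb E f(T(\mathbf G))\to0$ for every bounded continuous $f:\mathbb R^d\to\mathbb R$. 3. For every fixed $\mathbf u\in\mathbb R^m$ with $\mathbf u^\top\boldsymbol\Sigma(\mathbf v_q)\mathbf u>0$ for all large $t$, $\ \mathbf u^\top(\widehat{\boldsymbol\Delta}-\boldsymbol\mu(\mathbf v_q))/\sqrt{\mathbf u^\top\boldsymbol\Sigma(\mathbf v_q)\mathbf u}\xrightarrow{d}\mathcal N(0,1)$. -/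

import Mathlib

open MeasureTheory ProbabilityTheory Filter Topology Matrix

noncomputable section

namespace TFIDF

/-- A realized problem instance with `n` documents: a vocabulary of `vocab` terms, the realized
term counts of the query, the stop words, the term counts of the documents, the erasure
probability of one transmitted copy and the design rate. -/
structure RetrievalInstance (n : ℕ) where
  vocab : ℕ
  queryCount : Fin vocab → ℕ
  stopWords : Finset (Fin vocab)
  docCount : Fin n → Fin vocab → ℕ
  eps : ℝ
  eps_nonneg : 0 ≤ eps
  eps_le_one : eps ≤ 1
  rate : ℝ
  rate_pos : 0 < rate

/-- Term frequencies of a vector of counts: each count is divided by the total count. -/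
def termFreq {N : ℕ} (c : Fin N → ℕ) (i : Fin N) : ℝ := (c i : ℝ) / ((∑ l, c l : ℕ) : ℝ)

/-- Competitors of document `k`; `ℝᵐ` with `m = n - 1` is `EuclideanSpace ℝ (Competitor k)`. -/
abbrev Competitor {n : ℕ} (k : Fin n) : Type := {j : Fin n // j ≠ k}

namespace RetrievalInstance

variable {n : ℕ} (I : RetrievalInstance n)

/-- The query representation `v_q`: term frequencies with the stop-word coordinates set to zero. -/
def vq (i : Fin I.vocab) : ℝ := if i ∈ I.stopWords then 0 else termFreq I.queryCount i

/-- The support `S_q` of `v_q`. -/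
def supp : Finset (Fin I.vocab) := {i | I.vq i ≠ 0}

/-- `K_q = |S_q|`. -/
def numActive : ℕ := I.supp.card

/-- `M`, the number of query tokens that remain after stop-word removal. -/
def numTokens : ℕ := ∑ i ∈ (I.stopWords)ᶜ, I.queryCount i

/-- The number of repetitions `r_i = ⌈M / (R ∑_j v_{q,j}) * v_{q,i}⌉`. -/
def reps (i : Fin I.vocab) : ℕ := ⌈(I.numTokens : ℝ) / (I.rate * ∑ l, I.vq l) * I.vq i⌉₊

/-- The survival probability `p_i = 1 - ε ^ r_i`. -/
def surv (i : Fin I.vocab) : ℝ := 1 - I.eps ^ I.reps i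

/-- The term-frequency vectors of the documents. -/
def vd (j : Fin n) (i : Fin I.vocab) : ℝ := termFreq (I.docCount j) i

/-- `n_i`, the number of documents that contain term `i`. -/
def docFreq (i : Fin I.vocab) : ℕ := (Finset.univ.filter fun j => 0 < I.docCount j i).card

/-- The inverse document frequency `ζ_i = log ((n + 1) / (n_i + 1))`. -/
def idf (i : Fin I.vocab) : ℝ := Real.log (((n : ℝ) + 1) / ((I.docFreq i : ℝ) + 1))

/-- The score `ŝ_j = ∑_{i ∈ S_q} ζ_i² (v̂_{q,i} - v_{d_j,i})²` of document `j`, where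
`v̂_q = v_q ∘ e` is the query representation left over by the erasure pattern `e`. -/
def score (e : Fin I.vocab → ℝ) (j : Fin n) : ℝ :=
  ∑ i ∈ I.supp, I.idf i ^ 2 * (I.vq i * e i - I.vd j i) ^ 2

/-- The margin vector `Δ̂ = (ŝ_j - ŝ_k)_{j ≠ k}`. -/
def margin (k : Fin n) (e : Fin I.vocab → ℝ) : EuclideanSpace ℝ (Competitor k) :=
  WithLp.toLp 2 fun j => I.score e j - I.score e k

/-- The baseline contribution `C_i` of coordinate `i`. -/
def baseline (k : Fin n) (i : Fin I.vocab) : EuclideanSpace ℝ (Competitor k) :=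
  WithLp.toLp 2 fun j => I.idf i ^ 2 * (I.vd j i ^ 2 - I.vd k i ^ 2)

/-- The transmission-dependent contribution `δ_i` of coordinate `i`. -/
def delta (k : Fin n) (i : Fin I.vocab) : EuclideanSpace ℝ (Competitor k) :=
  WithLp.toLp 2 fun j => 2 * I.idf i ^ 2 * I.vq i * (I.vd k i - I.vd j i)

/-- `μ(v_q) = ∑_{i ∈ S_q} (C_i + p_i δ_i)`. -/
def mean (k : Fin n) : EuclideanSpace ℝ (Competitor k) :=
  ∑ i ∈ I.supp, (I.baseline k i + I.surv i • I.delta k i)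

/-- `Σ(v_q) = ∑_{i ∈ S_q} p_i (1 - p_i) δ_i δ_iᵀ`. -/
def cov (k : Fin n) : Matrix (Competitor k) (Competitor k) ℝ :=
  ∑ i ∈ I.supp,
    (I.surv i * (1 - I.surv i)) • Matrix.vecMulVec (I.delta k i).ofLp (I.delta k i).ofLp

/-- `e` is a vector of erasure indicators under `P`: its components are independent, `e_i` equals
`1` with probability `1 - ε ^ r_i` and `0` with probability `ε ^ r_i`. -/
structure IsErasure {Ω : Type*} [MeasurableSpace Ω] (P : Measure Ω)
    (e : Fin I.vocab → Ω → ℝ) : Prop where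
  measurable : ∀ i, Measurable (e i)
  indep : iIndepFun e P
  prob_one : ∀ i, P {ω | e i ω = 1} = ENNReal.ofReal (1 - I.eps ^ I.reps i)
  prob_zero : ∀ i, P {ω | e i ω = 0} = ENNReal.ofReal (I.eps ^ I.reps i)

end RetrievalInstance

/-- The asymptotic framework: a sequence of instances with `N_t → ∞` and `K_q → ∞`. -/
structure AsymptoticFramework {n : ℕ} (I : ℕ → RetrievalInstance n) : Prop where
  vocab_tendsto : Tendsto (fun t => (I t).vocab) atTop atTop
  active_tendsto : Tendsto (fun t => (I t).numActive) atTop atTop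

/-- The quadratic form `uᵀ S u`. -/
def quadForm {ι : Type*} [Fintype ι] (S : Matrix ι ι ℝ) (u : EuclideanSpace ℝ ι) : ℝ :=
  u.ofLp ⬝ᵥ (S *ᵥ u.ofLp)

/-- The directional Lindeberg condition for `Y_i = (e_i - p_i) δ_i`. The ratio is `0` at those `t`
at which `uᵀ Σ u = 0`. -/
def DirectionalLindeberg {n : ℕ} (k : Fin n) (I : ℕ → RetrievalInstance n)
    {Ω : ℕ → Type*} [∀ t, MeasurableSpace (Ω t)] (P : ∀ t, Measure (Ω t))
    (e : ∀ t, Fin (I t).vocab → Ω t → ℝ) : Prop :=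
  ∀ u : EuclideanSpace ℝ (Competitor k), ‖u‖ = 1 → ∀ η : ℝ, 0 < η →
    Tendsto (fun t =>
      1 / quadForm ((I t).cov k) u *
        ∑ i ∈ (I t).supp, ∫ ω,
          Set.indicator
            {ω' | η * √(quadForm ((I t).cov k) u) <
              |inner ℝ u ((e t i ω' - (I t).surv i) • (I t).delta k i)|}
            (fun ω' => (inner ℝ u ((e t i ω' - (I t).surv i) • (I t).delta k i)) ^ 2) ω ∂(P t))
      atTop (𝓝 0)

/-- Two sequences of laws approach each other weakly: the integrals of every bounded continuous
function become equal in the limit. If `ρ` is constant, this is weak convergence of `ν` to it. -/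
def WeaklyMerge {E : Type*} [TopologicalSpace E] [MeasurableSpace E] (ν ρ : ℕ → Measure E) : Prop :=
  ∀ f : BoundedContinuousFunction E ℝ,
    Tendsto (fun t => ∫ x, f x ∂(ν t) - ∫ x, f x ∂(ρ t)) atTop (𝓝 0)

/-- The coordinates of `x - μ` in the directions `u_1, …, u_d`, each divided by the standard
deviation `√(u_lᵀ S u_l)`; a direction with `u_lᵀ S u_l = 0` gives `0`. -/
def standardize {ι : Type*} [Fintype ι] (μ : EuclideanSpace ℝ ι) (S : Matrix ι ι ℝ) {d : ℕ}
    (u : Fin d → EuclideanSpace ℝ ι) (x : EuclideanSpace ℝ ι) : EuclideanSpace ℝ (Fin d) :=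
  WithLp.toLp 2 fun l => inner ℝ (u l) (x - μ) / √(quadForm S (u l))

/-- Convergence in distribution of the laws `ν_t` to `N(μ_t, S_t)`, where the Gaussian law moves
with `t`. -/
structure ConvergesToGaussian {ι : Type*} [Fintype ι] [DecidableEq ι]
    (ν : ℕ → Measure (EuclideanSpace ℝ ι)) (μ : ℕ → EuclideanSpace ℝ ι)
    (S : ℕ → Matrix ι ι ℝ) : Prop where
  /-- The laws approach the Gaussian laws weakly. -/
  merge : WeaklyMerge ν (fun t => multivariateGaussian (μ t) (S t))
  /-- They do so at the scale of the Gaussian laws too, jointly in any finitely many fixed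
  directions. -/
  merge_standardized : ∀ (d : ℕ) (u : Fin d → EuclideanSpace ℝ ι),
    WeaklyMerge (fun t => (ν t).map (standardize (μ t) (S t) u))
      (fun t => (multivariateGaussian (μ t) (S t)).map (standardize (μ t) (S t) u))
  /-- Every standardized one-dimensional projection converges to `N(0, 1)`. -/
  projection : ∀ u : EuclideanSpace ℝ ι, (∀ᶠ t in atTop, 0 < quadForm (S t) u) →
    WeaklyMerge (fun t => (ν t).map fun x => inner ℝ u (x - μ t) / √(quadForm (S t) u))
      (fun _ => gaussianReal 0 1)

end TFIDF

end

/-!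
The argument is the Lindeberg–Feller theorem by characteristic functions, in a form that allows both
the Gaussian law and the direction of projection to move along the sequence.

The squares of the indicators cancel in `ŝ_j - ŝ_k`, so the margin is affine in the indicators and
`⟪v, Δ̂ - μ⟫` is a sum of independent centred variables `⟪v, Y_i⟫` with total variance `vᵀ Σ v`.
Lindeberg's estimate `norm_charFun_sum_sub_le` compares its characteristic function with
`exp (-vᵀ Σ v / 2)`, and the error vanishes once the variances are bounded and the truncated second
moments tend to zero (`tendsto_charFun_sum_sub`).

The three kinds of convergence need directions that move: a fixed `w` for the laws themselves,
`∑ l, (w_l / σ_l) u_l` for the standardized ones and `(s / σ) u` for one projection, where the `σ`'s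
are the standard deviations in fixed directions and depend on `t`. All of these have the form
`∑ l, a_{t,l} u_l` with the `u_l` fixed and `a_{t,l} σ_{t,l}` bounded. The assumption in the fixed
directions `u_l` carries over to such combinations (`DirectionalLindeberg.tendsto_smul`, for one
direction, and `truncSecondMoment_sum_le`, for sums), which gives
`DirectionalLindeberg.tendsto_charFun_sub`.

For differences of characteristic functions to control differences of integrals of bounded
continuous functions, the Gaussian laws have to be tight: by Prokhorov's theorem every subsequence
has a further one along which they converge, and by Lévy's theorem the other laws converge to the
same limit (`WeaklyMerge.of_tendsto_charFun_sub`). Tightness is automatic for the standardized laws.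
For the laws themselves it holds because term frequencies sum to at most `1` and `ζ_i` is at most
`log (n + 1)`, so that `μ` and `Σ` are bounded in terms of `n` alone (`norm_mean_le`,
`quadForm_cov_le`).
-/

/-! ### Elementary estimates -/

lemma norm_prod_sub_prod_le_sum {ι : Type*} (s : Finset ι) (a b : ι → ℂ)
    (ha : ∀ i ∈ s, ‖a i‖ ≤ 1) (hb : ∀ i ∈ s, ‖b i‖ ≤ 1) :
    ‖∏ i ∈ s, a i - ∏ i ∈ s, b i‖ ≤ ∑ i ∈ s, ‖a i - b i‖ := by
  classical
  induction s using Finset.induction with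
  | empty => simp
  | insert i s hi ih =>
    have ih' := ih (fun j hj => ha j (Finset.mem_insert_of_mem hj))
      (fun j hj => hb j (Finset.mem_insert_of_mem hj))
    rw [Finset.prod_insert hi, Finset.prod_insert hi, Finset.sum_insert hi]
    have hP : ‖∏ j ∈ s, a j‖ ≤ 1 := by
      rw [norm_prod]
      exact Finset.prod_le_one (fun _ _ => norm_nonneg _)
        fun j hj => ha j (Finset.mem_insert_of_mem hj)
    calc ‖a i * ∏ j ∈ s, a j - b i * ∏ j ∈ s, b j‖
        = ‖(a i - b i) * ∏ j ∈ s, a j + b i * (∏ j ∈ s, a j - ∏ j ∈ s, b j)‖ := by ring_nf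
      _ ≤ ‖a i - b i‖ * ‖∏ j ∈ s, a j‖ + ‖b i‖ * ‖∏ j ∈ s, a j - ∏ j ∈ s, b j‖ := by
          refine (norm_add_le _ _).trans ?_
          rw [norm_mul, norm_mul]
      _ ≤ ‖a i - b i‖ * 1 + 1 * ∑ j ∈ s, ‖a j - b j‖ := by
          gcongr
          exact hb i (Finset.mem_insert_self _ _)
      _ = _ := by ring

lemma norm_cexp_mul_I_taylor_le_cube {x : ℝ} (hx : |x| ≤ 1) :
    ‖Complex.exp (x * Complex.I) - (1 + x * Complex.I - (x : ℂ) ^ 2 / 2)‖ ≤ 3 * |x| ^ 3 := by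
  have h := Complex.norm_exp_sub_sum_le_norm_mul_exp (x * Complex.I) 3
  have h1 : ∑ m ∈ Finset.range 3, ((x : ℂ) * Complex.I) ^ m / (m.factorial : ℂ)
      = 1 + x * Complex.I - (x : ℂ) ^ 2 / 2 := by
    simp [Finset.sum_range_succ, mul_pow]
    ring
  have h2 : ‖(x : ℂ) * Complex.I‖ = |x| := by simp
  rw [h1, h2] at h
  have h3 : Real.exp |x| ≤ 3 := by
    have := Real.exp_le_exp.2 hx
    have := Real.exp_one_lt_d9
    linarith
  calc _ ≤ |x| ^ 3 * Real.exp |x| := h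
    _ ≤ |x| ^ 3 * 3 := by gcongr
    _ = _ := by ring

lemma norm_cexp_mul_I_taylor_le_sq (x : ℝ) :
    ‖Complex.exp (x * Complex.I) - (1 + x * Complex.I - (x : ℂ) ^ 2 / 2)‖ ≤ 4 * x ^ 2 := by
  rcases le_or_gt |x| 1 with hx | hx
  · refine (norm_cexp_mul_I_taylor_le_cube hx).trans ?_
    rw [← sq_abs x]
    nlinarith [sq_nonneg |x|, abs_nonneg x]
  · have h1 : ‖(x : ℂ) * Complex.I‖ = |x| := by simp
    have h2 : ‖(x : ℂ) ^ 2 / 2‖ = |x| ^ 2 / 2 := by simp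
    calc _ ≤ ‖Complex.exp (x * Complex.I)‖ + (‖(1 : ℂ)‖ + ‖(x : ℂ) * Complex.I‖
            + ‖(x : ℂ) ^ 2 / 2‖) := by
          refine (norm_sub_le _ _).trans (add_le_add le_rfl ((norm_sub_le _ _).trans ?_))
          exact add_le_add (norm_add_le _ _) le_rfl
      _ = 1 + (1 + |x| + |x| ^ 2 / 2) := by
          rw [h1, h2, Complex.norm_exp_ofReal_mul_I, norm_one]
      _ ≤ 4 * x ^ 2 := by
          rw [← sq_abs x]
          nlinarith

lemma abs_exp_neg_sub_le {a : ℝ} (ha : 0 ≤ a) : |Real.exp (-a) - (1 - a)| ≤ a ^ 2 := by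
  rw [abs_of_nonneg (by linarith [Real.add_one_le_exp (-a)])]
  rcases le_or_gt a 1 with h | h
  · have := Real.abs_exp_sub_one_sub_id_le (x := -a) (by rwa [abs_neg, abs_of_nonneg ha])
    have := le_abs_self (Real.exp (-a) - 1 - -a)
    nlinarith
  · have : Real.exp (-a) ≤ 1 := by simpa using ha
    nlinarith

/-! ### Lindeberg's theorem for characteristic functions -/

section Lindeberg

variable {Ω : Type*} [MeasurableSpace Ω] {P : Measure Ω}

/-- The second moment of `X` on the event `η < |X|`. -/
noncomputable def truncSecondMoment (P : Measure Ω) (X : Ω → ℝ) (η : ℝ) : ℝ :=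
  ∫ ω, {ω' | η < |X ω'|}.indicator (fun ω' => X ω' ^ 2) ω ∂P

lemma truncSecondMoment_nonneg (X : Ω → ℝ) (η : ℝ) : 0 ≤ truncSecondMoment P X η :=
  integral_nonneg fun _ => Set.indicator_nonneg (fun _ _ => sq_nonneg _) _

lemma MeasureTheory.MemLp.integrable_indicator_lt_abs_sq {X : Ω → ℝ} (hX : MemLp X 2 P)
    (hm : Measurable X) (η : ℝ) :
    Integrable ({ω' | η < |X ω'|}.indicator fun ω' => X ω' ^ 2) P :=
  hX.integrable_sq.indicator (measurableSet_lt measurable_const hm.abs)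

lemma integral_sq_le_truncSecondMoment [IsProbabilityMeasure P] {X : Ω → ℝ} (hX : MemLp X 2 P)
    (hm : Measurable X) (η : ℝ) :
    ∫ ω, X ω ^ 2 ∂P ≤ η ^ 2 + truncSecondMoment P X η := by
  have h : ∫ ω, X ω ^ 2 ∂P ≤
      ∫ ω, (η ^ 2 + {ω' | η < |X ω'|}.indicator (fun ω' => X ω' ^ 2) ω) ∂P := by
    refine integral_mono hX.integrable_sq
      ((integrable_const _).add (hX.integrable_indicator_lt_abs_sq hm η)) fun ω => ?_
    by_cases hω : η < |X ω|
    · simp only [Set.indicator, Set.mem_ofPred_eq, hω, if_true]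
      nlinarith [sq_nonneg η]
    · simp only [Set.indicator, Set.mem_ofPred_eq, hω, if_false, add_zero]
      rw [← sq_abs]
      exact pow_le_pow_left₀ (abs_nonneg _) (not_lt.1 hω) 2
  rw [integral_add (integrable_const _) (hX.integrable_indicator_lt_abs_sq hm η)] at h
  simpa [truncSecondMoment] using h

/-- Second-order Taylor expansion of the characteristic function of a centred variable: the cubic
remainder is used on `|X| ≤ η`, the quadratic one on `η < |X|`. -/
lemma norm_charFun_sub_taylor_le [IsProbabilityMeasure P] {X : Ω → ℝ} (hX : MemLp X 2 P)
    (hm : Measurable X) (h0 : ∫ ω, X ω ∂P = 0) {η : ℝ} (hη : 0 ≤ η) (hη1 : η ≤ 1) :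
    ‖charFun (P.map X) 1 - ((1 - (∫ ω, X ω ^ 2 ∂P) / 2 : ℝ) : ℂ)‖ ≤
      3 * η * ∫ ω, X ω ^ 2 ∂P + 4 * truncSecondMoment P X η := by
  have hX1 : Integrable X P := hX.integrable (by norm_num)
  have hexp : Integrable (fun ω => Complex.exp (X ω * Complex.I)) P := by
    refine Integrable.of_bound (C := 1) (by fun_prop) (ae_of_all _ fun ω => ?_)
    rw [Complex.norm_exp_ofReal_mul_I]
  have hI1 : Integrable (fun ω => (X ω : ℂ) * Complex.I) P := hX1.ofReal.mul_const _
  have hI2 : Integrable (fun ω => (X ω : ℂ) ^ 2 / 2) P := by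
    have : Integrable (fun ω => ((X ω ^ 2 : ℝ) : ℂ)) P := hX.integrable_sq.ofReal
    simpa using this.div_const 2
  have hI3 : Integrable (fun ω => 1 + (X ω : ℂ) * Complex.I) P := (integrable_const _).add hI1
  have hT : Integrable (fun ω => 1 + (X ω : ℂ) * Complex.I - (X ω : ℂ) ^ 2 / 2) P := hI3.sub hI2
  have key : charFun (P.map X) 1 - ((1 - (∫ ω, X ω ^ 2 ∂P) / 2 : ℝ) : ℂ) =
      ∫ ω, (Complex.exp (X ω * Complex.I)
        - (1 + X ω * Complex.I - (X ω : ℂ) ^ 2 / 2)) ∂P := by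
    rw [integral_sub hexp hT, integral_sub hI3 hI2,
      integral_add (integrable_const _) hI1, integral_mul_const, integral_div,
      integral_complex_ofReal, h0, charFun_apply_real, integral_map hm.aemeasurable (by fun_prop)]
    have : ∫ ω, (X ω : ℂ) ^ 2 ∂P = ((∫ ω, X ω ^ 2 ∂P : ℝ) : ℂ) := by
      rw [← integral_complex_ofReal]; simp
    rw [this]
    simp
  rw [key]
  have hb : ∀ ω, ‖Complex.exp (X ω * Complex.I) - (1 + X ω * Complex.I - (X ω : ℂ) ^ 2 / 2)‖ ≤
      3 * η * X ω ^ 2 + 4 * {ω' | η < |X ω'|}.indicator (fun ω' => X ω' ^ 2) ω := by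
    intro ω
    by_cases hω : η < |X ω|
    · simp only [Set.indicator, Set.mem_ofPred_eq, hω, if_true]
      refine (norm_cexp_mul_I_taylor_le_sq _).trans ?_
      nlinarith [mul_nonneg hη (sq_nonneg (X ω))]
    · simp only [Set.indicator, Set.mem_ofPred_eq, hω, if_false, mul_zero, add_zero]
      have hω' := not_lt.1 hω
      refine (norm_cexp_mul_I_taylor_le_cube (hω'.trans hη1)).trans ?_
      rw [← sq_abs (X ω)]
      nlinarith [mul_le_mul_of_nonneg_right hω' (sq_nonneg |X ω|)]
  have hJ1 : Integrable (fun ω => 3 * η * X ω ^ 2) P := hX.integrable_sq.const_mul _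
  have hJ2 := (hX.integrable_indicator_lt_abs_sq hm η).const_mul 4
  refine (norm_integral_le_of_norm_le (hJ1.add hJ2) (ae_of_all _ hb)).trans_eq ?_
  simp only [Pi.add_apply]
  rw [integral_add hJ1 hJ2, integral_const_mul, integral_const_mul]
  rfl

/-- Lindeberg's estimate: the characteristic function of a sum of independent centred variables
differs from that of a Gaussian variable of the same variance by little if the truncated second
moments are small. -/
lemma norm_charFun_sum_sub_le [IsProbabilityMeasure P] {ι : Type*} (s : Finset ι)
    {X : ι → Ω → ℝ} (hind : iIndepFun X P) (hm : ∀ i, Measurable (X i))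
    (hX : ∀ i ∈ s, MemLp (X i) 2 P) (h0 : ∀ i ∈ s, ∫ ω, X i ω ∂P = 0)
    {η : ℝ} (hη : 0 ≤ η) (hη1 : η ≤ 1) :
    ‖charFun (P.map fun ω => ∑ i ∈ s, X i ω) 1
        - Complex.exp ((-(∑ i ∈ s, ∫ ω, X i ω ^ 2 ∂P) / 2 : ℝ))‖ ≤
      4 * η * ∑ i ∈ s, ∫ ω, X i ω ^ 2 ∂P
        + (4 + ∑ i ∈ s, ∫ ω, X i ω ^ 2 ∂P) * ∑ i ∈ s, truncSecondMoment P (X i) η := by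
  set V : ι → ℝ := fun i => ∫ ω, X i ω ^ 2 ∂P with hV
  set T : ι → ℝ := fun i => truncSecondMoment P (X i) η with hT
  have hV0 : ∀ i, 0 ≤ V i := fun i => integral_nonneg fun _ => sq_nonneg _
  have hT0 : ∀ i, 0 ≤ T i := fun i => truncSecondMoment_nonneg _ _
  have hprod : charFun (P.map fun ω => ∑ i ∈ s, X i ω) 1 = ∏ i ∈ s, charFun (P.map (X i)) 1 := by
    rw [iIndepFun.charFun_map_fun_finsetSum_eq_prod (fun i _ => (hm i).aemeasurable)
      (hind.restrict _), Finset.prod_apply]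
  have hexp : Complex.exp ((-(∑ i ∈ s, V i) / 2 : ℝ)) =
      ∏ i ∈ s, ((Real.exp (-(V i / 2)) : ℝ) : ℂ) := by
    rw [← Complex.ofReal_prod, ← Real.exp_sum, ← Complex.ofReal_exp, Finset.sum_neg_distrib,
      ← Finset.sum_div, neg_div]
  rw [hprod, hexp]
  have hsum : ∀ i ∈ s, ‖charFun (P.map (X i)) 1 - ((Real.exp (-(V i / 2)) : ℝ) : ℂ)‖ ≤
      4 * η * V i + 4 * T i + V i * ∑ j ∈ s, T j := by
    intro i hi
    have h1 := norm_charFun_sub_taylor_le (hX i hi) (hm i) (h0 i hi) hη hη1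
    have h2 : ‖((1 - V i / 2 : ℝ) : ℂ) - ((Real.exp (-(V i / 2)) : ℝ) : ℂ)‖ ≤ (V i / 2) ^ 2 := by
      rw [← Complex.ofReal_sub, Complex.norm_real, Real.norm_eq_abs, abs_sub_comm]
      exact abs_exp_neg_sub_le (by have := hV0 i; positivity)
    have h3 : V i ≤ η ^ 2 + T i := integral_sq_le_truncSecondMoment (hX i hi) (hm i) η
    have h4 : T i ≤ ∑ j ∈ s, T j := Finset.single_le_sum (fun j _ => hT0 j) hi
    have h5 := norm_sub_le_norm_sub_add_norm_sub (charFun (P.map (X i)) 1)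
      ((1 - V i / 2 : ℝ) : ℂ) ((Real.exp (-(V i / 2)) : ℝ) : ℂ)
    have h6 : V i * V i ≤ V i * (η + ∑ j ∈ s, T j) :=
      mul_le_mul_of_nonneg_left (by nlinarith) (hV0 i)
    have h7 : (V i / 2) ^ 2 ≤ V i * V i := by nlinarith [mul_self_nonneg (V i)]
    have h8 : ‖charFun (P.map (X i)) 1 - ((1 - V i / 2 : ℝ) : ℂ)‖ ≤ 3 * η * V i + 4 * T i := h1
    linarith
  refine (norm_prod_sub_prod_le_sum s _ _ (fun i _ => ?_) (fun i _ => ?_)).trans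
    ((Finset.sum_le_sum hsum).trans_eq ?_)
  · have := Measure.isProbabilityMeasure_map (μ := P) (hm i).aemeasurable
    exact norm_charFun_le_one _
  · rw [Complex.norm_real, Real.norm_eq_abs, abs_of_pos (Real.exp_pos _), Real.exp_le_one_iff]
    have := hV0 i
    linarith
  · rw [Finset.sum_add_distrib, Finset.sum_add_distrib, ← Finset.mul_sum, ← Finset.mul_sum,
      ← Finset.sum_mul]
    ring

end Lindeberg

/-- The Lindeberg–Feller theorem for a triangular array whose row variances are bounded but need not
converge. -/
lemma tendsto_charFun_sum_sub {Ω ι : ℕ → Type*} [∀ t, MeasurableSpace (Ω t)]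
    (P : ∀ t, Measure (Ω t)) [∀ t, IsProbabilityMeasure (P t)] (s : ∀ t, Finset (ι t))
    {X : ∀ t, ι t → Ω t → ℝ} (hind : ∀ t, iIndepFun (X t) (P t))
    (hm : ∀ t i, Measurable (X t i)) (hX : ∀ t, ∀ i ∈ s t, MemLp (X t i) 2 (P t))
    (h0 : ∀ t, ∀ i ∈ s t, ∫ ω, X t i ω ∂(P t) = 0) {B : ℝ}
    (hB : ∀ t, ∑ i ∈ s t, ∫ ω, X t i ω ^ 2 ∂(P t) ≤ B)
    (hlind : ∀ η : ℝ, 0 < η →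
      Tendsto (fun t => ∑ i ∈ s t, truncSecondMoment (P t) (X t i) η) atTop (𝓝 0)) :
    Tendsto (fun t => charFun ((P t).map fun ω => ∑ i ∈ s t, X t i ω) 1
      - Complex.exp ((-(∑ i ∈ s t, ∫ ω, X t i ω ^ 2 ∂(P t)) / 2 : ℝ))) atTop (𝓝 0) := by
  have hB0 : 0 ≤ B :=
    (Finset.sum_nonneg fun i _ => integral_nonneg fun _ => sq_nonneg _).trans (hB 0)
  rw [Metric.tendsto_atTop]
  intro ε hε
  -- `η` is chosen so that `4 η B ≤ ε / 2`.
  set η : ℝ := min 1 (ε / (8 * (B + 1))) with hη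
  have hη0 : 0 < η := lt_min one_pos (by positivity)
  have hηB : 4 * η * B ≤ ε / 2 := by
    have h1 : η ≤ ε / (8 * (B + 1)) := min_le_right _ _
    rw [le_div_iff₀ (by positivity)] at h1
    nlinarith
  obtain ⟨N, hN⟩ := Metric.tendsto_atTop.1 (hlind η hη0) (ε / (2 * (4 + B))) (by positivity)
  refine ⟨N, fun t ht => ?_⟩
  have h1 := norm_charFun_sum_sub_le (s t) (hind t) (hm t) (hX t) (h0 t) hη0.le (min_le_left _ _)
  have hT0 : 0 ≤ ∑ i ∈ s t, truncSecondMoment (P t) (X t i) η :=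
    Finset.sum_nonneg fun i _ => truncSecondMoment_nonneg _ _
  have h2 := hN t ht
  rw [Real.dist_eq, sub_zero, abs_of_nonneg hT0, lt_div_iff₀ (by positivity)] at h2
  rw [dist_zero_right]
  have h3 : 4 * η * ∑ i ∈ s t, ∫ ω, X t i ω ^ 2 ∂(P t) ≤ 4 * η * B := by
    gcongr; exact hB t
  have h4 : (4 + ∑ i ∈ s t, ∫ ω, X t i ω ^ 2 ∂(P t)) *
      ∑ i ∈ s t, truncSecondMoment (P t) (X t i) η ≤
      (4 + B) * ∑ i ∈ s t, truncSecondMoment (P t) (X t i) η := by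
    gcongr; exact hB t
  linarith

/-! ### Weak merging and tightness -/

section Merge

variable {E : Type*} [NormedAddCommGroup E] [InnerProductSpace ℝ E] [FiniteDimensional ℝ E]
  [MeasurableSpace E] [BorelSpace E]

/-- If one of two sequences of laws is tight and their characteristic functions become equal in the
limit, the laws merge weakly. -/
theorem TFIDF.WeaklyMerge.of_tendsto_charFun_sub {ν ρ : ℕ → Measure E}
    [hν : ∀ t, IsProbabilityMeasure (ν t)] [hρ : ∀ t, IsProbabilityMeasure (ρ t)]
    (hρt : IsTightMeasureSet (Set.range ρ))
    (h : ∀ w, Tendsto (fun t => charFun (ν t) w - charFun (ρ t) w) atTop (𝓝 0)) :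
    TFIDF.WeaklyMerge ν ρ := by
  intro f
  refine tendsto_of_subseq_tendsto fun ns hns => ?_
  let N : ℕ → ProbabilityMeasure E := fun t => ⟨ν t, hν t⟩
  let R : ℕ → ProbabilityMeasure E := fun t => ⟨ρ t, hρ t⟩
  have hcomp : IsCompact (closure (Set.range R)) := by
    refine isCompact_closure_of_isTightMeasureSet ?_
    convert hρt using 1
    ext m
    constructor
    · rintro ⟨_, ⟨t, rfl⟩, rfl⟩
      exact ⟨t, rfl⟩
    · rintro ⟨t, rfl⟩
      exact ⟨R t, ⟨t, rfl⟩, rfl⟩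
  obtain ⟨ρ₀, -, φ, hφ, hlim⟩ :=
    hcomp.tendsto_subseq (x := fun k => R (ns k)) fun k => subset_closure ⟨_, rfl⟩
  have hsub : Tendsto (fun k => ns (φ k)) atTop atTop := hns.comp hφ.tendsto_atTop
  have hR : Tendsto (fun k => R (ns (φ k))) atTop (𝓝 ρ₀) := hlim
  have hN : Tendsto (fun k => N (ns (φ k))) atTop (𝓝 ρ₀) := by
    rw [ProbabilityMeasure.tendsto_iff_tendsto_charFun] at hR ⊢
    intro w
    simpa [N, R] using ((h w).comp hsub).add (hR w)
  refine ⟨φ, ?_⟩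
  rw [ProbabilityMeasure.tendsto_iff_forall_integral_tendsto] at hR hN
  simpa [N, R] using (hN f).sub (hR f)

end Merge

/-- Chebyshev's inequality: bounded second moments in every direction make a sequence tight. -/
theorem isTightMeasureSet_range_of_second_moment {E : Type*} [NormedAddCommGroup E]
    [InnerProductSpace ℝ E] [FiniteDimensional ℝ E] [MeasurableSpace E] {ρ : ℕ → Measure E}
    [∀ t, IsProbabilityMeasure (ρ t)]
    (h : ∀ y : E, ∃ C : ℝ, ∀ t, MemLp (fun x => inner ℝ y x) 2 (ρ t) ∧
      ∫ x, (inner ℝ y x) ^ 2 ∂(ρ t) ≤ C) :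
    IsTightMeasureSet (Set.range ρ) := by
  refine isTightMeasureSet_of_inner_tendsto ℝ fun y => ?_
  obtain ⟨C, hC⟩ := h y
  have hlim : Tendsto (fun r : ℝ => ENNReal.ofReal (C / r ^ 2)) atTop (𝓝 0) := by
    rw [← ENNReal.ofReal_zero]
    exact ENNReal.tendsto_ofReal
      (tendsto_const_nhds.div_atTop (tendsto_pow_atTop (two_ne_zero)))
  refine tendsto_of_tendsto_of_tendsto_of_le_of_le' tendsto_const_nhds hlim
    (Eventually.of_forall fun _ => zero_le) ?_
  filter_upwards [eventually_gt_atTop 0] with r hr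
  rw [iSup_range]
  refine iSup_le fun t => ?_
  have hm := mul_meas_ge_le_integral_of_nonneg (μ := ρ t) (f := fun x => (inner ℝ y x) ^ 2)
    (ae_of_all _ fun _ => sq_nonneg _) (hC t).1.integrable_sq (r ^ 2)
  have hsub : {x | r < ‖inner ℝ y x‖} ⊆ {x | r ^ 2 ≤ (inner ℝ y x) ^ 2} := by
    intro x hx
    simp only [Set.mem_ofPred_eq, Real.norm_eq_abs] at hx ⊢
    rw [← sq_abs (inner ℝ y x)]
    exact pow_le_pow_left₀ hr.le hx.le 2
  rw [← ofReal_measureReal]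
  refine ENNReal.ofReal_le_ofReal ?_
  rw [le_div_iff₀ (by positivity), mul_comm]
  refine le_trans ?_ (hm.trans (hC t).2)
  exact mul_le_mul_of_nonneg_left (measureReal_mono hsub) (sq_nonneg r)

/-! ### Truncated second moments of multiples and sums -/

section Trunc

variable {Ω : Type*} [MeasurableSpace Ω] {P : Measure Ω}

lemma truncSecondMoment_le_integral_sq {X : Ω → ℝ} (hX : MemLp X 2 P) (hm : Measurable X) (η : ℝ) :
    truncSecondMoment P X η ≤ ∫ ω, X ω ^ 2 ∂P :=
  integral_mono (hX.integrable_indicator_lt_abs_sq hm η) hX.integrable_sq fun ω =>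
    Set.indicator_le_self' (fun _ _ => sq_nonneg _) ω

lemma truncSecondMoment_const_mul_le {X : Ω → ℝ} (hX : MemLp X 2 P) (hm : Measurable X)
    {a η η' : ℝ} (h : |a| * η' ≤ η) :
    truncSecondMoment P (fun ω => a * X ω) η ≤ a ^ 2 * truncSecondMoment P X η' := by
  unfold truncSecondMoment
  rw [← integral_const_mul]
  refine integral_mono ((hX.const_mul a).integrable_indicator_lt_abs_sq (hm.const_mul a) η)
    ((hX.integrable_indicator_lt_abs_sq hm η').const_mul _) fun ω => ?_
  by_cases hω : η < |a * X ω|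
  · have hω' : η' < |X ω| := by
      rw [abs_mul] at hω
      exact lt_of_mul_lt_mul_left (h.trans_lt hω) (abs_nonneg a)
    simp only [Set.indicator, Set.mem_ofPred_eq, hω, hω', if_true]
    rw [mul_pow]
  · simp only [Set.indicator, Set.mem_ofPred_eq, hω, if_false]
    split_ifs <;> positivity

/-- If a finite sum exceeds `η` in absolute value, its largest term exceeds `η / card ι`; the tails
of the sum are therefore dominated by those of its terms. -/
lemma truncSecondMoment_sum_le {ι : Type*} [Fintype ι] {X : ι → Ω → ℝ}
    (hX : ∀ l, MemLp (X l) 2 P) (hm : ∀ l, Measurable (X l)) {η : ℝ} (hη : 0 ≤ η) :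
    truncSecondMoment P (fun ω => ∑ l, X l ω) η ≤
      (Fintype.card ι : ℝ) ^ 2 * ∑ l, truncSecondMoment P (X l) (η / Fintype.card ι) := by
  unfold truncSecondMoment
  rw [← integral_finsetSum _ fun l _ => (hX l).integrable_indicator_lt_abs_sq (hm l) _,
    ← integral_const_mul]
  refine integral_mono
    ((memLp_finsetSum _ fun l _ => hX l).integrable_indicator_lt_abs_sq
      (Finset.measurable_sum _ fun l _ => hm l) η)
    ((integrable_finsetSum _ fun l _ =>
      (hX l).integrable_indicator_lt_abs_sq (hm l) _).const_mul _) fun ω => ?_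
  have hnn : ∀ l, 0 ≤ {ω' | η / Fintype.card ι < |X l ω'|}.indicator (fun ω' => X l ω' ^ 2) ω :=
    fun l => Set.indicator_nonneg (fun _ _ => sq_nonneg _) _
  by_cases hω : η < |∑ l, X l ω|
  · have hne : (Finset.univ : Finset ι).Nonempty := by
      by_contra hemp
      rw [Finset.not_nonempty_iff_eq_empty] at hemp
      rw [hemp, Finset.sum_empty, abs_zero] at hω
      linarith
    obtain ⟨l₀, -, hl₀⟩ := Finset.exists_max_image Finset.univ (fun l => |X l ω|) hne
    have hcard : 0 < (Fintype.card ι : ℝ) := by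
      exact_mod_cast Finset.card_pos.2 hne
    have hle : |∑ l, X l ω| ≤ Fintype.card ι * |X l₀ ω| := by
      refine (Finset.abs_sum_le_sum_abs _ _).trans ((Finset.sum_le_sum hl₀).trans_eq ?_)
      simp
    have hω' : η / Fintype.card ι < |X l₀ ω| := by
      rw [div_lt_iff₀ hcard]
      linarith
    have h1 : X l₀ ω ^ 2 ≤
        ∑ l, {ω' | η / Fintype.card ι < |X l ω'|}.indicator (fun ω' => X l ω' ^ 2) ω := by
      refine le_trans (le_of_eq ?_)
        (Finset.single_le_sum (fun l _ => hnn l) (Finset.mem_univ l₀))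
      simp only [Set.indicator, Set.mem_ofPred_eq, hω', if_true]
    have h2 : (∑ l, X l ω) ^ 2 ≤ (Fintype.card ι : ℝ) ^ 2 * X l₀ ω ^ 2 := by
      rw [← sq_abs, ← sq_abs (X l₀ ω), ← mul_pow]
      exact pow_le_pow_left₀ (abs_nonneg _) hle 2
    have h3 : {ω' | η < |∑ l, X l ω'|}.indicator (fun ω' => (∑ l, X l ω') ^ 2) ω
        = (∑ l, X l ω) ^ 2 := by
      simp only [Set.indicator, Set.mem_ofPred_eq, hω, if_true]
    rw [h3]
    exact h2.trans (mul_le_mul_of_nonneg_left h1 (sq_nonneg _))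
  · have h3 : {ω' | η < |∑ l, X l ω'|}.indicator (fun ω' => (∑ l, X l ω') ^ 2) ω = 0 := by
      simp only [Set.indicator, Set.mem_ofPred_eq, hω, if_false]
    rw [h3]
    exact mul_nonneg (sq_nonneg _) (Finset.sum_nonneg fun l _ => hnn l)

end Trunc

/-! ### Bounds on the mean and the covariance -/

lemma EuclideanSpace.norm_le_card_mul {ι : Type*} [Fintype ι] (x : EuclideanSpace ℝ ι) {c : ℝ}
    (h : ∀ j, |x j| ≤ c) : ‖x‖ ≤ Fintype.card ι * c := by
  classical
  calc ‖x‖ = ‖∑ j, x j • EuclideanSpace.single j (1 : ℝ)‖ := by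
        congr 1
        ext j
        simp [Finset.sum_apply, Pi.single_apply]
    _ ≤ ∑ j, ‖x j • EuclideanSpace.single j (1 : ℝ)‖ := norm_sum_le _ _
    _ ≤ ∑ _j : ι, c := Finset.sum_le_sum fun j _ => by simpa [norm_smul] using h j
    _ = _ := by simp

namespace TFIDF

lemma termFreq_nonneg {N : ℕ} (c : Fin N → ℕ) (i : Fin N) : 0 ≤ termFreq c i := by
  unfold termFreq; positivity

lemma sum_termFreq_le_one {N : ℕ} (c : Fin N → ℕ) : ∑ i, termFreq c i ≤ 1 := by
  unfold termFreq
  rw [← Finset.sum_div, ← Nat.cast_sum]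
  exact div_self_le_one _

lemma termFreq_le_one {N : ℕ} (c : Fin N → ℕ) (i : Fin N) : termFreq c i ≤ 1 :=
  (Finset.single_le_sum (fun j _ => termFreq_nonneg c j) (Finset.mem_univ i)).trans
    (sum_termFreq_le_one c)

namespace RetrievalInstance

variable {n : ℕ} (I : RetrievalInstance n) (k : Fin n)

lemma vq_nonneg (i : Fin I.vocab) : 0 ≤ I.vq i := by
  unfold vq; split_ifs
  exacts [le_rfl, termFreq_nonneg _ _]

lemma vq_le_termFreq (i : Fin I.vocab) : I.vq i ≤ termFreq I.queryCount i := by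
  unfold vq; split_ifs
  exacts [termFreq_nonneg _ _, le_rfl]

lemma vq_le_one (i : Fin I.vocab) : I.vq i ≤ 1 :=
  (I.vq_le_termFreq i).trans (termFreq_le_one _ _)

lemma sum_supp_vq_le_one : ∑ i ∈ I.supp, I.vq i ≤ 1 :=
  (Finset.sum_le_univ_sum_of_nonneg I.vq_nonneg).trans
    ((Finset.sum_le_sum fun i _ => I.vq_le_termFreq i).trans (sum_termFreq_le_one _))

lemma sum_supp_vd_le_one (j : Fin n) : ∑ i ∈ I.supp, I.vd j i ≤ 1 :=
  (Finset.sum_le_univ_sum_of_nonneg fun i => termFreq_nonneg _ i).trans (sum_termFreq_le_one _)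

lemma vd_nonneg (j : Fin n) (i : Fin I.vocab) : 0 ≤ I.vd j i := termFreq_nonneg _ _

lemma vd_le_one (j : Fin n) (i : Fin I.vocab) : I.vd j i ≤ 1 := termFreq_le_one _ _

lemma surv_nonneg (i : Fin I.vocab) : 0 ≤ I.surv i :=
  sub_nonneg.2 (pow_le_one₀ I.eps_nonneg I.eps_le_one)

lemma surv_le_one (i : Fin I.vocab) : I.surv i ≤ 1 :=
  sub_le_self _ (pow_nonneg I.eps_nonneg _)

lemma idf_nonneg (i : Fin I.vocab) : 0 ≤ I.idf i := by
  refine Real.log_nonneg ?_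
  rw [le_div_iff₀ (by positivity), one_mul]
  have : I.docFreq i ≤ n := (Finset.card_filter_le _ _).trans (by simp)
  have : (I.docFreq i : ℝ) ≤ n := by exact_mod_cast this
  linarith

lemma idf_sq_le (i : Fin I.vocab) : I.idf i ^ 2 ≤ Real.log ((n : ℝ) + 1) ^ 2 := by
  refine pow_le_pow_left₀ (I.idf_nonneg i) (Real.log_le_log (by positivity) ?_) 2
  exact div_le_self (by positivity) (by simp)

lemma norm_delta_le (i : Fin I.vocab) :
    ‖I.delta k i‖ ≤ 2 * n * Real.log ((n : ℝ) + 1) ^ 2 * I.vq i := by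
  have hv := I.vq_nonneg i
  have hcard : (Fintype.card (Competitor k) : ℝ) ≤ n := by
    exact_mod_cast (Fintype.card_subtype_le _).trans (by simp)
  refine (EuclideanSpace.norm_le_card_mul (c := 2 * Real.log ((n : ℝ) + 1) ^ 2 * I.vq i) _
    fun j => ?_).trans ?_
  · have h1 : |I.vd k i - I.vd j i| ≤ 1 := by
      rw [abs_le]
      constructor <;> linarith [I.vd_nonneg k i, I.vd_nonneg j i, I.vd_le_one k i, I.vd_le_one j i]
    change |2 * I.idf i ^ 2 * I.vq i * (I.vd k i - I.vd j i)| ≤ _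
    rw [abs_mul, abs_of_nonneg (by positivity)]
    have h2 := I.idf_sq_le i
    calc _ ≤ 2 * Real.log ((n : ℝ) + 1) ^ 2 * I.vq i * 1 := by gcongr
      _ = _ := mul_one _
  · calc _ ≤ (n : ℝ) * (2 * Real.log ((n : ℝ) + 1) ^ 2 * I.vq i) := by gcongr
      _ = _ := by ring

lemma norm_sum_baseline_le :
    ‖∑ i ∈ I.supp, I.baseline k i‖ ≤ 2 * n * Real.log ((n : ℝ) + 1) ^ 2 := by
  have hcard : (Fintype.card (Competitor k) : ℝ) ≤ n := by
    exact_mod_cast (Fintype.card_subtype_le _).trans (by simp)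
  refine (EuclideanSpace.norm_le_card_mul (c := 2 * Real.log ((n : ℝ) + 1) ^ 2) _
    fun j => ?_).trans ?_
  · have hcoord : (∑ i ∈ I.supp, I.baseline k i) j =
        ∑ i ∈ I.supp, I.idf i ^ 2 * (I.vd j i ^ 2 - I.vd k i ^ 2) := by
      simp [baseline]
    have hterm : ∀ i ∈ I.supp, |I.idf i ^ 2 * (I.vd j i ^ 2 - I.vd k i ^ 2)| ≤
        Real.log ((n : ℝ) + 1) ^ 2 * (I.vd j i + I.vd k i) := by
      intro i _
      rw [abs_mul, abs_of_nonneg (sq_nonneg _)]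
      refine mul_le_mul (I.idf_sq_le i) ?_ (abs_nonneg _) (sq_nonneg _)
      rw [abs_le]
      constructor <;> nlinarith [I.vd_nonneg k i, I.vd_nonneg j i, I.vd_le_one k i, I.vd_le_one j i]
    rw [hcoord]
    refine (Finset.abs_sum_le_sum_abs _ _).trans ((Finset.sum_le_sum hterm).trans ?_)
    rw [← Finset.mul_sum, Finset.sum_add_distrib]
    have h1 := I.sum_supp_vd_le_one j
    have h2 := I.sum_supp_vd_le_one k
    nlinarith [sq_nonneg (Real.log ((n : ℝ) + 1))]
  · calc _ ≤ (n : ℝ) * (2 * Real.log ((n : ℝ) + 1) ^ 2) := by gcongr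
      _ = _ := by ring

lemma norm_mean_le : ‖I.mean k‖ ≤ 4 * n * Real.log ((n : ℝ) + 1) ^ 2 := by
  have h1 := I.norm_sum_baseline_le k
  have h2 : ‖∑ i ∈ I.supp, I.surv i • I.delta k i‖ ≤ 2 * n * Real.log ((n : ℝ) + 1) ^ 2 := by
    calc _ ≤ ∑ i ∈ I.supp, 2 * n * Real.log ((n : ℝ) + 1) ^ 2 * I.vq i := by
          refine norm_sum_le_of_le _ fun i _ => ?_
          rw [norm_smul, Real.norm_eq_abs, abs_of_nonneg (I.surv_nonneg i)]
          exact (mul_le_of_le_one_left (norm_nonneg _) (I.surv_le_one i)).trans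
            (I.norm_delta_le k i)
      _ = 2 * n * Real.log ((n : ℝ) + 1) ^ 2 * ∑ i ∈ I.supp, I.vq i := by rw [Finset.mul_sum]
      _ ≤ _ := mul_le_of_le_one_right (by positivity) I.sum_supp_vq_le_one
  rw [mean, Finset.sum_add_distrib]
  refine (norm_add_le _ _).trans ?_
  linarith

lemma quadForm_cov (u : EuclideanSpace ℝ (Competitor k)) :
    quadForm (I.cov k) u =
      ∑ i ∈ I.supp, I.surv i * (1 - I.surv i) * (inner ℝ u (I.delta k i)) ^ 2 := by
  unfold quadForm cov
  rw [Matrix.sum_mulVec, dotProduct_sum]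
  refine Finset.sum_congr rfl fun i _ => ?_
  rw [Matrix.smul_mulVec, dotProduct_smul, Matrix.vecMulVec_mulVec, smul_eq_mul]
  have : inner ℝ u (I.delta k i) = u.ofLp ⬝ᵥ (I.delta k i).ofLp := by
    rw [EuclideanSpace.inner_eq_star_dotProduct, dotProduct_comm]; simp
  rw [this]
  congr 1
  simp [dotProduct_smul, dotProduct_comm, sq]

lemma surv_mul_one_sub_nonneg (i : Fin I.vocab) : 0 ≤ I.surv i * (1 - I.surv i) :=
  mul_nonneg (I.surv_nonneg i) (sub_nonneg.2 (I.surv_le_one i))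

lemma quadForm_cov_nonneg (u : EuclideanSpace ℝ (Competitor k)) : 0 ≤ quadForm (I.cov k) u := by
  rw [quadForm_cov]
  exact Finset.sum_nonneg fun i _ => mul_nonneg (I.surv_mul_one_sub_nonneg i) (sq_nonneg _)

lemma posSemidef_cov : (I.cov k).PosSemidef := by
  refine Matrix.posSemidef_sum _ fun i _ => ?_
  refine Matrix.PosSemidef.smul ?_ (I.surv_mul_one_sub_nonneg i)
  simpa using Matrix.posSemidef_vecMulVec_self_star (I.delta k i).ofLp

lemma quadForm_cov_smul (a : ℝ) (u : EuclideanSpace ℝ (Competitor k)) :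
    quadForm (I.cov k) (a • u) = a ^ 2 * quadForm (I.cov k) u := by
  rw [quadForm_cov, quadForm_cov, Finset.mul_sum]
  refine Finset.sum_congr rfl fun i _ => ?_
  rw [real_inner_smul_left]
  ring

lemma quadForm_cov_sum_le {d : ℕ} (u : Fin d → EuclideanSpace ℝ (Competitor k)) :
    quadForm (I.cov k) (∑ l, u l) ≤ d * ∑ l, quadForm (I.cov k) (u l) := by
  simp_rw [quadForm_cov]
  rw [Finset.sum_comm, Finset.mul_sum]
  refine Finset.sum_le_sum fun i _ => ?_
  rw [sum_inner, ← Finset.mul_sum, mul_left_comm]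
  refine mul_le_mul_of_nonneg_left ?_ (I.surv_mul_one_sub_nonneg i)
  simpa using sq_sum_le_card_mul_sum_sq (s := Finset.univ)
    (f := fun l => inner ℝ (u l) (I.delta k i))

/-- The bound depends on the instance through `n` only: `‖δ_i‖` is at most a multiple of `v_{q,i}`,
and the `v_{q,i}` lie in `[0, 1]` and sum to at most `1`. -/
lemma quadForm_cov_le (u : EuclideanSpace ℝ (Competitor k)) :
    quadForm (I.cov k) u ≤ (2 * n * Real.log ((n : ℝ) + 1) ^ 2 * ‖u‖) ^ 2 := by
  set C : ℝ := 2 * n * Real.log ((n : ℝ) + 1) ^ 2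
  rw [quadForm_cov]
  have hterm : ∀ i ∈ I.supp, I.surv i * (1 - I.surv i) * (inner ℝ u (I.delta k i)) ^ 2 ≤
      (C * ‖u‖) ^ 2 * I.vq i := by
    intro i _
    have h1 : I.surv i * (1 - I.surv i) ≤ 1 := by
      nlinarith [I.surv_nonneg i, I.surv_le_one i]
    have h2 : |inner ℝ u (I.delta k i)| ≤ C * ‖u‖ * I.vq i := by
      calc _ ≤ ‖u‖ * ‖I.delta k i‖ := abs_real_inner_le_norm _ _
        _ ≤ ‖u‖ * (C * I.vq i) := by gcongr; exact I.norm_delta_le k i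
        _ = _ := by ring
    have h3 : (inner ℝ u (I.delta k i)) ^ 2 ≤ (C * ‖u‖ * I.vq i) ^ 2 := by
      rw [← sq_abs]
      exact pow_le_pow_left₀ (abs_nonneg _) h2 2
    have h4 : I.vq i ^ 2 ≤ I.vq i := by nlinarith [I.vq_nonneg i, I.vq_le_one i]
    calc _ ≤ 1 * (C * ‖u‖ * I.vq i) ^ 2 :=
          mul_le_mul h1 h3 (sq_nonneg _) zero_le_one
      _ = (C * ‖u‖) ^ 2 * I.vq i ^ 2 := by ring
      _ ≤ _ := by gcongr
  refine (Finset.sum_le_sum hterm).trans ?_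
  rw [← Finset.mul_sum]
  exact mul_le_of_le_one_right (sq_nonneg _) I.sum_supp_vq_le_one

/-! ### The margin as a sum of independent contributions -/

/-- The terms `(v_{q,i} e_i)²` are common to all the scores and cancel in the margin, which is why
no assumption on the values of `e` is needed. -/
lemma margin_eq_sum (e : Fin I.vocab → ℝ) :
    I.margin k e = ∑ i ∈ I.supp, (I.baseline k i + e i • I.delta k i) := by
  ext j
  simp only [margin, score, baseline, delta, WithLp.ofLp_sum, WithLp.ofLp_add, WithLp.ofLp_smul,
    Finset.sum_apply, Pi.add_apply, Pi.smul_apply, smul_eq_mul]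
  rw [← Finset.sum_sub_distrib]
  exact Finset.sum_congr rfl fun i _ => by ring

/-- The projection `⟪v, Y_i⟫` of the centred contribution `Y_i = (e_i - p_i) δ_i` of term `i`. -/
noncomputable def noise {Ω : Type*} (e : Fin I.vocab → Ω → ℝ) (v : EuclideanSpace ℝ (Competitor k))
    (i : Fin I.vocab) (ω : Ω) : ℝ :=
  inner ℝ v ((e i ω - I.surv i) • I.delta k i)

variable {I k}

lemma noise_eq {Ω : Type*} (e : Fin I.vocab → Ω → ℝ) (v : EuclideanSpace ℝ (Competitor k))
    (i : Fin I.vocab) (ω : Ω) :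
    I.noise k e v i ω = (e i ω - I.surv i) * inner ℝ v (I.delta k i) :=
  real_inner_smul_right _ _ _

lemma noise_smul {Ω : Type*} (e : Fin I.vocab → Ω → ℝ) (a : ℝ) (v : EuclideanSpace ℝ (Competitor k))
    (i : Fin I.vocab) : I.noise k e (a • v) i = fun ω => a * I.noise k e v i ω :=
  funext fun _ => real_inner_smul_left _ _ _

lemma noise_sum {Ω : Type*} {d : ℕ} (e : Fin I.vocab → Ω → ℝ)
    (v : Fin d → EuclideanSpace ℝ (Competitor k))
    (i : Fin I.vocab) : I.noise k e (∑ l, v l) i = fun ω => ∑ l, I.noise k e (v l) i ω :=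
  funext fun _ => sum_inner _ _ _

lemma inner_margin_sub_mean {Ω : Type*} (e : Fin I.vocab → Ω → ℝ)
    (v : EuclideanSpace ℝ (Competitor k))
    (ω : Ω) : inner ℝ v (I.margin k (fun i => e i ω) - I.mean k) =
      ∑ i ∈ I.supp, I.noise k e v i ω := by
  rw [margin_eq_sum, mean, ← Finset.sum_sub_distrib, inner_sum]
  refine Finset.sum_congr rfl fun i _ => ?_
  rw [add_sub_add_left_eq_sub, ← sub_smul]
  rfl

section Erasure

variable {Ω : Type*} [MeasurableSpace Ω] {P : Measure Ω} {e : Fin I.vocab → Ω → ℝ}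

lemma IsErasure.measureReal_one (he : I.IsErasure P e) (i : Fin I.vocab) :
    P.real {ω | e i ω = 1} = I.surv i := by
  rw [measureReal_def, he.prob_one]
  exact ENNReal.toReal_ofReal (I.surv_nonneg i)

lemma IsErasure.measureReal_zero (he : I.IsErasure P e) (i : Fin I.vocab) :
    P.real {ω | e i ω = 0} = 1 - I.surv i := by
  rw [measureReal_def, he.prob_zero, ENNReal.toReal_ofReal (pow_nonneg I.eps_nonneg _), surv]
  ring

lemma IsErasure.ae_eq_one_or_zero [IsProbabilityMeasure P] (he : I.IsErasure P e)
    (i : Fin I.vocab) :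
    ∀ᵐ ω ∂P, e i ω = 1 ∨ e i ω = 0 := by
  have hm1 : MeasurableSet {ω | e i ω = 1} := he.measurable i (measurableSet_singleton 1)
  have hm0 : MeasurableSet {ω | e i ω = 0} := he.measurable i (measurableSet_singleton 0)
  have hdisj : Disjoint {ω | e i ω = 1} {ω | e i ω = 0} := by
    rw [Set.disjoint_left]
    intro ω h1 h0
    have h1' : e i ω = 1 := h1
    have h0' : e i ω = 0 := h0
    linarith
  have h : P.real ({ω | e i ω = 1} ∪ {ω | e i ω = 0}) = 1 := by
    rw [measureReal_union hdisj hm0, he.measureReal_one, he.measureReal_zero]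
    ring
  rw [measureReal_def, ENNReal.toReal_eq_one_iff] at h
  exact (mem_ae_iff_prob_eq_one (hm1.union hm0)).2 h

/-- The indicator `e_i` takes only the values `1` and `0` almost surely, so `g` is arbitrary. -/
lemma IsErasure.integral_comp [IsProbabilityMeasure P] (he : I.IsErasure P e)
    (i : Fin I.vocab) (g : ℝ → ℝ) :
    ∫ ω, g (e i ω) ∂P = I.surv i * g 1 + (1 - I.surv i) * g 0 := by
  have hm1 : MeasurableSet {ω | e i ω = 1} := he.measurable i (measurableSet_singleton 1)
  have hm0 : MeasurableSet {ω | e i ω = 0} := he.measurable i (measurableSet_singleton 0)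
  have hae : (fun ω => g (e i ω)) =ᵐ[P] fun ω => {ω | e i ω = 1}.indicator (fun _ => g 1) ω
      + {ω | e i ω = 0}.indicator (fun _ => g 0) ω := by
    filter_upwards [he.ae_eq_one_or_zero i] with ω hω
    rcases hω with hω | hω <;> simp [Set.indicator, hω]
  rw [integral_congr_ae hae, integral_add ((integrable_const _).indicator hm1)
    ((integrable_const _).indicator hm0), integral_indicator_const _ hm1,
    integral_indicator_const _ hm0, he.measureReal_one, he.measureReal_zero, smul_eq_mul,
    smul_eq_mul]

lemma IsErasure.measurable_noise (he : I.IsErasure P e) (v : EuclideanSpace ℝ (Competitor k))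
    (i : Fin I.vocab) : Measurable (I.noise k e v i) := by
  have := he.measurable i
  unfold noise
  fun_prop

lemma IsErasure.memLp_noise [IsProbabilityMeasure P] (he : I.IsErasure P e)
    (v : EuclideanSpace ℝ (Competitor k))
    (i : Fin I.vocab) : MemLp (I.noise k e v i) 2 P := by
  refine MemLp.of_bound (he.measurable_noise v i).aestronglyMeasurable
    |inner ℝ v (I.delta k i)| ?_
  filter_upwards [he.ae_eq_one_or_zero i] with ω hω
  rw [noise_eq, Real.norm_eq_abs, abs_mul]
  refine mul_le_of_le_one_left (abs_nonneg _) ?_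
  have h1 := I.surv_nonneg i
  have h2 := I.surv_le_one i
  rw [abs_le]
  rcases hω with hω | hω <;> rw [hω] <;> constructor <;> linarith

lemma IsErasure.integral_noise [IsProbabilityMeasure P] (he : I.IsErasure P e)
    (v : EuclideanSpace ℝ (Competitor k))
    (i : Fin I.vocab) : ∫ ω, I.noise k e v i ω ∂P = 0 := by
  simp_rw [noise_eq]
  rw [he.integral_comp i fun x => (x - I.surv i) * inner ℝ v (I.delta k i)]
  ring

lemma IsErasure.sum_integral_noise_sq [IsProbabilityMeasure P] (he : I.IsErasure P e)
    (v : EuclideanSpace ℝ (Competitor k)) :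
    ∑ i ∈ I.supp, ∫ ω, I.noise k e v i ω ^ 2 ∂P = quadForm (I.cov k) v := by
  rw [quadForm_cov]
  refine Finset.sum_congr rfl fun i _ => ?_
  simp_rw [noise_eq]
  rw [he.integral_comp i fun x => ((x - I.surv i) * inner ℝ v (I.delta k i)) ^ 2]
  ring

lemma IsErasure.iIndepFun_noise (he : I.IsErasure P e) (v : EuclideanSpace ℝ (Competitor k)) :
    iIndepFun (I.noise k e v) P :=
  he.indep.comp (fun i x => inner ℝ v ((x - I.surv i) • I.delta k i)) fun i => by fun_prop

lemma IsErasure.measurable_margin (he : I.IsErasure P e) :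
    Measurable fun ω => I.margin k fun i => e i ω := by
  have := he.measurable
  simp_rw [margin_eq_sum]
  fun_prop

end Erasure

end RetrievalInstance

end TFIDF

/-! ### Projections of the Gaussian law -/

section Gaussian

variable {ι : Type*} [Fintype ι]

lemma charFun_map_inner_sub (m v : EuclideanSpace ℝ ι) (ν : Measure (EuclideanSpace ℝ ι)) :
    charFun (ν.map fun x => inner ℝ v (x - m)) 1 =
      ∫ x, Complex.exp ((inner ℝ v (x - m) : ℝ) * Complex.I) ∂ν := by
  rw [charFun_apply_real, integral_map (by fun_prop) (by fun_prop)]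
  simp

lemma charFun_map_inner_sub_eq_mul (m v : EuclideanSpace ℝ ι)
    (ν : Measure (EuclideanSpace ℝ ι)) :
    charFun (ν.map fun x => inner ℝ v (x - m)) 1 =
      Complex.exp ((-inner ℝ v m : ℝ) * Complex.I) * charFun ν v := by
  rw [charFun_map_inner_sub, charFun_apply, ← integral_const_mul]
  refine integral_congr_ae (ae_of_all _ fun x => ?_)
  simp only
  rw [← Complex.exp_add, inner_sub_right, real_inner_comm v x]
  push_cast
  ring_nf

variable [DecidableEq ι] {S : Matrix ι ι ℝ}

lemma charFun_multivariateGaussian_map_inner_sub (hS : S.PosSemidef) (m v : EuclideanSpace ℝ ι) :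
    charFun ((multivariateGaussian m S).map fun x => inner ℝ v (x - m)) 1 =
      Complex.exp ((-TFIDF.quadForm S v / 2 : ℝ)) := by
  rw [charFun_map_inner_sub_eq_mul, charFun_multivariateGaussian hS, ← Complex.exp_add]
  congr 1
  simp only [TFIDF.quadForm]
  push_cast
  ring

lemma memLp_inner_sub_multivariateGaussian (m v : EuclideanSpace ℝ ι) :
    MemLp (fun x => inner ℝ v (x - m)) 2 (multivariateGaussian m S) :=
  (((IsGaussian.memLp_two_id (μ := multivariateGaussian m S)).sub (memLp_const m)).const_inner v)

lemma integral_inner_sub_sq_multivariateGaussian (hS : S.PosSemidef)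
    (m v : EuclideanSpace ℝ ι) :
    ∫ x, (inner ℝ v (x - m)) ^ 2 ∂(multivariateGaussian m S) = TFIDF.quadForm S v := by
  have h := covarianceBilin_multivariateGaussian (μ := m) hS v v
  rw [covarianceBilin_apply IsGaussian.memLp_two_id, integral_id_multivariateGaussian'] at h
  simp only [sq]
  exact h

end Gaussian

namespace TFIDF

/-- The standardization is dual to a rescaled combination of the directions. -/
lemma inner_standardize {ι : Type*} [Fintype ι] (m : EuclideanSpace ℝ ι) (S : Matrix ι ι ℝ) {d : ℕ}
    (u : Fin d → EuclideanSpace ℝ ι) (w : EuclideanSpace ℝ (Fin d)) (x : EuclideanSpace ℝ ι) :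
    inner ℝ w (standardize m S u x) =
      inner ℝ (∑ l, (w l / √(quadForm S (u l))) • u l) (x - m) := by
  rw [sum_inner, PiLp.inner_apply]
  refine Finset.sum_congr rfl fun l _ => ?_
  rw [real_inner_smul_left]
  simp only [standardize, RCLike.inner_apply, conj_trivial]
  ring

lemma measurable_standardize {ι : Type*} [Fintype ι] (m : EuclideanSpace ℝ ι) (S : Matrix ι ι ℝ)
    {d : ℕ} (u : Fin d → EuclideanSpace ℝ ι) : Measurable (standardize m S u) := by
  unfold standardize
  fun_prop

/-! ### Convergence of the margin -/

open RetrievalInstance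

variable {n : ℕ} {k : Fin n} {I : ℕ → RetrievalInstance n} {Ω : ℕ → Type*}
  [∀ t, MeasurableSpace (Ω t)] {P : ∀ t, Measure (Ω t)} [∀ t, IsProbabilityMeasure (P t)]
  {e : ∀ t, Fin (I t).vocab → Ω t → ℝ}

/-- The Lindeberg condition in the fixed direction `u` passes to its multiples `a_t u`, as long as
the standard deviation in the direction `a_t u` stays bounded. -/
lemma DirectionalLindeberg.tendsto_smul (hlind : DirectionalLindeberg k I P e)
    (he : ∀ t, (I t).IsErasure (P t) (e t)) (u : EuclideanSpace ℝ (Competitor k)) {a : ℕ → ℝ}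
    {B : ℝ} (hB : ∀ t, |a t| * √(quadForm ((I t).cov k) u) ≤ B) {η : ℝ} (hη : 0 < η) :
    Tendsto (fun t => ∑ i ∈ (I t).supp,
      truncSecondMoment (P t) ((I t).noise k (e t) (a t • u) i) η) atTop (𝓝 0) := by
  rcases eq_or_ne u 0 with rfl | hu
  · simp [truncSecondMoment, noise]
  have hB0 : 0 ≤ B := (by positivity : (0 : ℝ) ≤ _).trans (hB 0)
  have hun : 0 < ‖u‖ := norm_pos_iff.2 hu
  set w : EuclideanSpace ℝ (Competitor k) := ‖u‖⁻¹ • u with hw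
  have hw1 : ‖w‖ = 1 := norm_smul_inv_norm hu
  set b : ℕ → ℝ := fun t => a t * ‖u‖ with hb
  have hbw : ∀ t, a t • u = b t • w := fun t => by
    rw [hb, hw, smul_smul, mul_assoc, mul_inv_cancel₀ hun.ne', mul_one]
  -- `B` may be `0`; `B + 1` is positive and can be divided by.
  have hbB : ∀ t, |b t| * √(quadForm ((I t).cov k) w) ≤ B + 1 := by
    intro t
    have h : quadForm ((I t).cov k) w = (‖u‖⁻¹) ^ 2 * quadForm ((I t).cov k) u :=
      (I t).quadForm_cov_smul k _ _
    rw [h, Real.sqrt_mul (sq_nonneg _), Real.sqrt_sq (inv_nonneg.2 hun.le), abs_mul,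
      abs_of_pos hun]
    have h2 : |a t| * ‖u‖ * (‖u‖⁻¹ * √(quadForm ((I t).cov k) u)) =
        |a t| * √(quadForm ((I t).cov k) u) := by
      field_simp
    rw [h2]
    linarith [hB t]
  have hlim := (hlind w hw1 (η / (B + 1)) (by positivity)).const_mul ((B + 1) ^ 2)
  rw [mul_zero] at hlim
  refine squeeze_zero (fun t => Finset.sum_nonneg fun i _ => truncSecondMoment_nonneg _ _)
    (fun t => ?_) hlim
  set q := quadForm ((I t).cov k) w with hq
  set T : Fin (I t).vocab → ℝ := fun i =>
    truncSecondMoment (P t) ((I t).noise k (e t) w i) (η / (B + 1) * √q) with hT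
  change _ ≤ (B + 1) ^ 2 * (1 / q * ∑ i ∈ (I t).supp, T i)
  have hq0 : 0 ≤ q := (I t).quadForm_cov_nonneg k w
  have hT0 : 0 ≤ ∑ i ∈ (I t).supp, T i := Finset.sum_nonneg fun i _ => truncSecondMoment_nonneg _ _
  have hTq : ∑ i ∈ (I t).supp, T i ≤ q := by
    rw [hq, ← (he t).sum_integral_noise_sq w]
    exact Finset.sum_le_sum fun i _ =>
      truncSecondMoment_le_integral_sq ((he t).memLp_noise w i) ((he t).measurable_noise w i) _
  have hscale : |b t| * (η / (B + 1) * √q) ≤ η := by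
    calc _ = η / (B + 1) * (|b t| * √q) := by ring
      _ ≤ η / (B + 1) * (B + 1) := mul_le_mul_of_nonneg_left (hbB t) (by positivity)
      _ = η := div_mul_cancel₀ _ (by positivity)
  have h1 : ∑ i ∈ (I t).supp, truncSecondMoment (P t) ((I t).noise k (e t) (a t • u) i) η ≤
      b t ^ 2 * ∑ i ∈ (I t).supp, T i := by
    rw [Finset.mul_sum]
    refine Finset.sum_le_sum fun i _ => ?_
    rw [hbw, noise_smul]
    exact truncSecondMoment_const_mul_le ((he t).memLp_noise w i) ((he t).measurable_noise w i)
      hscale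
  refine h1.trans ?_
  -- If `q = 0` the normalized sum is `0` by convention, but then so are the truncated moments.
  rcases hq0.eq_or_lt with hq' | hq'
  · have : ∑ i ∈ (I t).supp, T i = 0 := le_antisymm (hTq.trans hq'.ge) hT0
    rw [this]
    simp
  · have h2 : b t ^ 2 * q ≤ (B + 1) ^ 2 := by
      have := pow_le_pow_left₀ (by positivity) (hbB t) 2
      rwa [mul_pow, sq_abs, Real.sq_sqrt hq0] at this
    calc b t ^ 2 * ∑ i ∈ (I t).supp, T i
        = b t ^ 2 * q * (1 / q * ∑ i ∈ (I t).supp, T i) := by field_simp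
      _ ≤ _ := mul_le_mul_of_nonneg_right h2 (mul_nonneg (by positivity) hT0)

/-- In directions `∑ l, a_{t,l} u_l` that move with `t` but are combinations of fixed directions
of bounded standard deviation, the margin and the Gaussian vector have asymptotically the same
characteristic function. -/
lemma DirectionalLindeberg.tendsto_charFun_sub (hlind : DirectionalLindeberg k I P e)
    (he : ∀ t, (I t).IsErasure (P t) (e t)) {d : ℕ} (u : Fin d → EuclideanSpace ℝ (Competitor k))
    {a : ℕ → Fin d → ℝ} {B : ℝ} (hB : ∀ t l, |a t l| * √(quadForm ((I t).cov k) (u l)) ≤ B) :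
    Tendsto (fun t =>
      charFun (((P t).map fun ω => (I t).margin k fun i => e t i ω).map
        fun x => inner ℝ (∑ l, a t l • u l) (x - (I t).mean k)) 1
      - charFun ((multivariateGaussian ((I t).mean k) ((I t).cov k)).map
        fun x => inner ℝ (∑ l, a t l • u l) (x - (I t).mean k)) 1) atTop (𝓝 0) := by
  have hvar : ∀ t, quadForm ((I t).cov k) (∑ l, a t l • u l) ≤ d * (d * B ^ 2) := by
    intro t
    refine ((I t).quadForm_cov_sum_le k _).trans (mul_le_mul_of_nonneg_left ?_ d.cast_nonneg)
    refine (Finset.sum_le_sum (g := fun _ => B ^ 2) fun l _ => ?_).trans_eq (by simp)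
    have := pow_le_pow_left₀ (by positivity) (hB t l) 2
    rwa [mul_pow, sq_abs, Real.sq_sqrt ((I t).quadForm_cov_nonneg k _),
      ← quadForm_cov_smul] at this
  have h := tendsto_charFun_sum_sub P (fun t => (I t).supp)
    (X := fun t => (I t).noise k (e t) (∑ l, a t l • u l))
    (fun t => (he t).iIndepFun_noise _) (fun t i => (he t).measurable_noise _ i)
    (fun t i _ => (he t).memLp_noise _ i) (fun t i _ => (he t).integral_noise _ i)
    (fun t => ((he t).sum_integral_noise_sq _).trans_le (hvar t)) ?_
  · refine h.congr fun t => ?_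
    rw [(he t).sum_integral_noise_sq,
      charFun_multivariateGaussian_map_inner_sub ((I t).posSemidef_cov k),
      Measure.map_map (by fun_prop) (he t).measurable_margin]
    congr 4
    funext ω
    exact (inner_margin_sub_mean _ _ _).symm
  · intro η hη
    rcases Nat.eq_zero_or_pos d with rfl | hd
    · simp [truncSecondMoment, noise]
    have hd' : (0 : ℝ) < d := by exact_mod_cast hd
    have hlim : Tendsto (fun t => (d : ℝ) ^ 2 * ∑ l, ∑ i ∈ (I t).supp,
        truncSecondMoment (P t) ((I t).noise k (e t) (a t l • u l) i) (η / d)) atTop (𝓝 0) := by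
      simpa using (tendsto_finsetSum Finset.univ fun l _ =>
        hlind.tendsto_smul he (u l) (fun t => hB t l) (div_pos hη hd')).const_mul ((d : ℝ) ^ 2)
    refine squeeze_zero (fun t => Finset.sum_nonneg fun i _ => truncSecondMoment_nonneg _ _)
      (fun t => ?_) hlim
    rw [Finset.sum_comm, Finset.mul_sum]
    refine Finset.sum_le_sum fun i _ => ?_
    rw [noise_sum]
    simpa using truncSecondMoment_sum_le
      (X := fun l => (I t).noise k (e t) (a t l • u l) i)
      (fun l => (he t).memLp_noise _ i) (fun l => (he t).measurable_noise _ i) hη.le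

/-- `a / σ` times `σ` is at most `|a|`, also when `σ = 0`. -/
lemma abs_div_mul_le (a : ℝ) {σ : ℝ} (hσ : 0 ≤ σ) : |a / σ| * σ ≤ |a| := by
  rw [abs_div, abs_of_nonneg hσ, div_mul_eq_mul_div, mul_div_assoc]
  exact mul_le_of_le_one_right (abs_nonneg _) (div_self_le_one _)

lemma DirectionalLindeberg.weaklyMerge (hlind : DirectionalLindeberg k I P e)
    (he : ∀ t, (I t).IsErasure (P t) (e t)) : WeaklyMerge
    (fun t => (P t).map fun ω => (I t).margin k (fun i => e t i ω))
    (fun t => multivariateGaussian ((I t).mean k) ((I t).cov k)) := by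
  have hprob : ∀ t, IsProbabilityMeasure ((P t).map fun ω => (I t).margin k fun i => e t i ω) :=
    fun t => Measure.isProbabilityMeasure_map (he t).measurable_margin.aemeasurable
  set L : ℝ := Real.log ((n : ℝ) + 1) ^ 2 with hL
  refine WeaklyMerge.of_tendsto_charFun_sub
    (isTightMeasureSet_range_of_second_moment fun y =>
      ⟨2 * (2 * n * L * ‖y‖) ^ 2 + 2 * (‖y‖ * (4 * n * L)) ^ 2, fun t => ⟨?_, ?_⟩⟩) fun w => ?_
  · exact IsGaussian.memLp_two_id.const_inner y
  · set m := (I t).mean k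
    have hI := (memLp_inner_sub_multivariateGaussian (S := (I t).cov k) m y).integrable_sq
    have h1 : ∫ x, (inner ℝ y x) ^ 2 ∂(multivariateGaussian m ((I t).cov k)) ≤
        ∫ x, (2 * (inner ℝ y (x - m)) ^ 2 + 2 * (inner ℝ y m) ^ 2)
          ∂(multivariateGaussian m ((I t).cov k)) := by
      refine integral_mono (IsGaussian.memLp_two_id.const_inner y).integrable_sq
        ((hI.const_mul 2).add (integrable_const _)) fun x => ?_
      simp only [inner_sub_right]
      nlinarith [sq_nonneg (inner ℝ y x - 2 * inner ℝ y m)]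
    rw [integral_add (hI.const_mul 2) (integrable_const _), integral_const_mul,
      integral_inner_sub_sq_multivariateGaussian ((I t).posSemidef_cov k)] at h1
    have h2 := (I t).quadForm_cov_le k y
    have h3 : (inner ℝ y m) ^ 2 ≤ (‖y‖ * (4 * n * L)) ^ 2 := by
      rw [← sq_abs]
      refine pow_le_pow_left₀ (abs_nonneg _) ((abs_real_inner_le_norm _ _).trans ?_) 2
      exact mul_le_mul_of_nonneg_left ((I t).norm_mean_le k) (norm_nonneg _)
    simp only [integral_const, probReal_univ, one_smul] at h1
    linarith
  · have h := hlind.tendsto_charFun_sub he (d := 1) (fun _ => w) (a := fun _ _ => 1)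
      (B := 2 * n * L * ‖w‖) fun t _ => by
        rw [abs_one, one_mul]
        exact Real.sqrt_le_iff.2 ⟨by positivity, (I t).quadForm_cov_le k w⟩
    rw [tendsto_zero_iff_norm_tendsto_zero] at h ⊢
    refine h.congr fun t => ?_
    simp only [Finset.univ_unique, Finset.sum_singleton, one_smul]
    rw [charFun_map_inner_sub_eq_mul, charFun_map_inner_sub_eq_mul, ← mul_sub, norm_mul,
      Complex.norm_exp_ofReal_mul_I, one_mul]

lemma DirectionalLindeberg.weaklyMerge_standardize (hlind : DirectionalLindeberg k I P e)
    (he : ∀ t, (I t).IsErasure (P t) (e t)) {d : ℕ}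
    (u : Fin d → EuclideanSpace ℝ (Competitor k)) : WeaklyMerge
    (fun t => ((P t).map fun ω => (I t).margin k (fun i => e t i ω)).map
      (standardize ((I t).mean k) ((I t).cov k) u))
    (fun t => (multivariateGaussian ((I t).mean k) ((I t).cov k)).map
      (standardize ((I t).mean k) ((I t).cov k) u)) := by
  have hprob : ∀ t, IsProbabilityMeasure ((P t).map fun ω => (I t).margin k fun i => e t i ω) :=
    fun t => Measure.isProbabilityMeasure_map (he t).measurable_margin.aemeasurable
  have hms : ∀ t, Measurable (standardize ((I t).mean k) ((I t).cov k) u) := fun t =>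
    measurable_standardize _ _ _
  have hν : ∀ t, IsProbabilityMeasure (((P t).map fun ω => (I t).margin k (fun i => e t i ω)).map
      (standardize ((I t).mean k) ((I t).cov k) u)) := fun t =>
    Measure.isProbabilityMeasure_map (hms t).aemeasurable
  have hρ : ∀ t, IsProbabilityMeasure ((multivariateGaussian ((I t).mean k) ((I t).cov k)).map
      (standardize ((I t).mean k) ((I t).cov k) u)) := fun t =>
    Measure.isProbabilityMeasure_map (hms t).aemeasurable
  refine WeaklyMerge.of_tendsto_charFun_sub
    (isTightMeasureSet_range_of_second_moment fun y =>
      ⟨d * ∑ l, y l ^ 2, fun t => ⟨?_, ?_⟩⟩) fun w => ?_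
  · rw [memLp_map_measure_iff (by fun_prop) (hms t).aemeasurable]
    simp only [Function.comp_def, inner_standardize]
    exact memLp_inner_sub_multivariateGaussian _ _
  · rw [integral_map (hms t).aemeasurable (by fun_prop)]
    simp only [inner_standardize]
    rw [integral_inner_sub_sq_multivariateGaussian ((I t).posSemidef_cov k)]
    refine ((I t).quadForm_cov_sum_le k _).trans (mul_le_mul_of_nonneg_left ?_ d.cast_nonneg)
    refine Finset.sum_le_sum fun l _ => ?_
    have hq := (I t).quadForm_cov_nonneg k (u l)
    have := pow_le_pow_left₀ (by positivity)
      (abs_div_mul_le (y l) (Real.sqrt_nonneg (quadForm ((I t).cov k) (u l)))) 2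
    rwa [mul_pow, sq_abs, sq_abs, Real.sq_sqrt hq, ← quadForm_cov_smul] at this
  -- Each `u_l` contributes standard deviation at most `|w l|` to the combined direction.
  · have h := hlind.tendsto_charFun_sub he u
      (a := fun t l => w l / √(quadForm ((I t).cov k) (u l))) (B := ∑ l, |w l|) fun t l =>
        (abs_div_mul_le _ (Real.sqrt_nonneg _)).trans
          (Finset.single_le_sum (fun j _ => abs_nonneg (w j)) (Finset.mem_univ l))
    have hchar : ∀ t (ν : Measure (EuclideanSpace ℝ (Competitor k))),
        charFun (ν.map (standardize ((I t).mean k) ((I t).cov k) u)) w =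
        charFun (ν.map fun x => inner ℝ (∑ l, (w l / √(quadForm ((I t).cov k) (u l))) • u l)
          (x - (I t).mean k)) 1 := by
      intro t ν
      rw [charFun_map_inner_sub, charFun_apply, integral_map (hms t).aemeasurable (by fun_prop)]
      simp only [real_inner_comm w, inner_standardize]
    simpa only [hchar] using h

lemma DirectionalLindeberg.weaklyMerge_projection (hlind : DirectionalLindeberg k I P e)
    (he : ∀ t, (I t).IsErasure (P t) (e t))
    (u : EuclideanSpace ℝ (Competitor k))
    (hu : ∀ᶠ t in atTop, 0 < quadForm ((I t).cov k) u) : WeaklyMerge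
    (fun t => ((P t).map fun ω => (I t).margin k (fun i => e t i ω)).map
      fun x => inner ℝ u (x - (I t).mean k) / √(quadForm ((I t).cov k) u))
    (fun _ => gaussianReal 0 1) := by
  have hprob : ∀ t, IsProbabilityMeasure ((P t).map fun ω => (I t).margin k fun i => e t i ω) :=
    fun t => Measure.isProbabilityMeasure_map (he t).measurable_margin.aemeasurable
  have hν : ∀ t, IsProbabilityMeasure (((P t).map fun ω => (I t).margin k (fun i => e t i ω)).map
      fun x => inner ℝ u (x - (I t).mean k) / √(quadForm ((I t).cov k) u)) := fun t =>
    Measure.isProbabilityMeasure_map (by fun_prop)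
  refine WeaklyMerge.of_tendsto_charFun_sub ?_ fun s => ?_
  · rw [Set.range_const]
    exact isTightMeasureSet_singleton
  · have h := hlind.tendsto_charFun_sub he (d := 1) (fun _ => u)
      (a := fun t _ => s / √(quadForm ((I t).cov k) u)) (B := |s|) fun t _ =>
        abs_div_mul_le _ (Real.sqrt_nonneg _)
    refine h.congr' ?_
    filter_upwards [hu] with t ht
    simp only [Finset.univ_unique, Finset.sum_singleton]
    congr 1
    · rw [charFun_map_inner_sub, charFun_apply_real,
        integral_map (φ := fun x => inner ℝ u (x - (I t).mean k) / √(quadForm ((I t).cov k) u))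
          (by fun_prop) (by fun_prop)]
      refine integral_congr_ae (ae_of_all _ fun x => ?_)
      simp only
      rw [real_inner_smul_left, ← Complex.ofReal_mul]
      congr 3
      ring
    · rw [charFun_multivariateGaussian_map_inner_sub ((I t).posSemidef_cov k),
        quadForm_cov_smul, charFun_gaussianReal, div_pow, Real.sq_sqrt ht.le,
        div_mul_cancel₀ _ ht.ne']
      simp [neg_div]

end TFIDF

theorem lemma2 {n : ℕ} (k : Fin n) (I : ℕ → TFIDF.RetrievalInstance n)
    {Ω : ℕ → Type*} [∀ t, MeasurableSpace (Ω t)]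
    (P : ∀ t, Measure (Ω t)) [∀ t, IsProbabilityMeasure (P t)]
    (e : ∀ t, Fin (I t).vocab → Ω t → ℝ)
    (he : ∀ t, (I t).IsErasure (P t) (e t))
    (hframe : TFIDF.AsymptoticFramework I)
    (hlind : TFIDF.DirectionalLindeberg k I P e) :
    (∀ t ω, (I t).margin k (fun i => e t i ω) =
      ∑ i ∈ (I t).supp, ((I t).baseline k i + e t i ω • (I t).delta k i)) ∧
    (∀ t, iIndepFun (fun i ω => (I t).baseline k i + e t i ω • (I t).delta k i) (P t)) ∧
    TFIDF.ConvergesToGaussian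
      (fun t => (P t).map fun ω => (I t).margin k (fun i => e t i ω))
      (fun t => (I t).mean k) (fun t => (I t).cov k) := by
  refine ⟨fun t ω => (I t).margin_eq_sum k _, fun t => ?_, hlind.weaklyMerge he,
    fun d u => hlind.weaklyMerge_standardize he u, hlind.weaklyMerge_projection he⟩
  exact (he t).indep.comp (fun i x => (I t).baseline k i + x • (I t).delta k i)
    fun i => by fun_prop
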